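/- Let $X_1, X_2, \ldots$ be independent, identically distributed real random variables, not assumed to be normal, with a finite fourth moment, mean $\mu$, variance $\sigma^2 > 0$ and excess kurtosis $\kappa = \mathbb{E}[(X_1-\mu)^4]/\sigma^4 - 3$. For a sample of size $n$ let $$\hat\mu_n = \frac1n\sum_{i=1}^n X_i, \qquad \hat\sigma_n^2 = \frac1n\sum_{i=1}^n (X_i - \hat\mu_n)^2 ,$$ let $\mathcal{I}(m, v)$ be the Fisher information matrix of one observation in the normal model $\{\mathcal{N}(m,v) : m \in \mathbb{R},\ v > 0\}$, parametrized by mean and variance, and let $\widehat{\mathrm{se}}_n = \sqrt{(\mathcal{I}(\hat\mu_n, \hat\sigma_n^2)^{-1})_{22}/n}$ be the normal-theory standard error of $\hat\sigma_n^2$ (set to $0$ if $\hat\sigma_n^2 = 0$). Let $\mathrm{sd}(\hat\sigma_n^2) = \sqrt{\operatorname{Var}(\hat\sigma_n^2)}$ be the actual standard error. Then: 1. Whenever $\hat\sigma_n^2 > 0$, the pair $(\hat\mu_n, \hat\sigma_n^2)$ is the unique maximizer of the normal likelihood of the sample over $m \in \mathbb{R}$, $v > 0$. 2. $\sqrt n\,(\hat\sigma_n^2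 - \sigma^2)$ converges in distribution to $\mathcal{N}(0, \sigma^4(\kappa+2))$, where $\sigma^4(\kappa+2) \ge 0$; also $\operatorname{Var}(\hat\sigma_n^2)$ is finite and $n \operatorname{Var}(\hat\sigma_n^2) \to \sigma^4(\kappa+2)$. 3. $\mathcal{I}(\mu, \sigma^2) = \begin{pmatrix} 1/\sigma^2 & 0 \\ 0 & 1/(2\sigma^4)\end{pmatrix}$ and $\mathcal{I}(\mu, \sigma^2)^{-1} = \begin{pmatrix} \sigma^2 & 0 \\ 0 & 2\sigma^4\end{pmatrix}$, so the normal theory predicts the asymptotic variance $2\sigma^4$. It agrees with $\sigma^4(\kappa+2)$ if and only if $\kappa = 0$, is smaller if and only if $\kappa > 0$, and is larger if and only if $\kappa < 0$. 4. The normal-theory standard error is integrable, and $\sqrt n\,\bigl(\mathbb{E}[\widehat{\mathrm{se}}_n] - \mathrm{sd}(\hat\sigma_n^2)\bigr) \to \sigma^2\bigl(\sqrt2 - \sqrt{\kappa+2}\bigr)$. If $\kappa > 0$, it is too small: $\mathbb{E}[\widehat{\mathrm{se}}_n] < \mathrm{sd}(\hat\sigma_n^2)$ for all sufficiently large $n$,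 and $\mathbb{P}\bigl(\widehat{\mathrm{se}}_n < \mathrm{sd}(\hat\sigma_n^2)\bigr) \to 1$. If $\kappa < 0$, it is too large: $\mathbb{E}[\widehat{\mathrm{se}}_n] > \mathrm{sd}(\hat\sigma_n^2)$ for all sufficiently large $n$, and $\mathbb{P}\bigl(\widehat{\mathrm{se}}_n > \mathrm{sd}(\hat\sigma_n^2)\bigr) \to 1$. -/

import Mathlib

open MeasureTheory ProbabilityTheory Filter
open scoped Topology

noncomputable section

/-- The density of the normal distribution with mean `θ 0` and variance `θ 1`; the parameter space
of the normal model is `{θ | 0 < θ 1}`. -/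
def normalDensity (θ : Fin 2 → ℝ) (x : ℝ) : ℝ :=
  gaussianPDFReal (θ 0) (θ 1).toNNReal x

/-- The likelihood of the parameter `θ = (mean, variance)` in the normal model, given the
sample `x`. -/
def normalLikelihood {n : ℕ} (x : Fin n → ℝ) (θ : Fin 2 → ℝ) : ℝ :=
  ∏ i, normalDensity θ (x i)

/-- `θ` is a maximum likelihood estimate for the sample `x` in the normal model. -/
def IsNormalMLE {n : ℕ} (x : Fin n → ℝ) (θ : Fin 2 → ℝ) : Prop :=
  0 < θ 1 ∧ ∀ θ' : Fin 2 → ℝ, 0 < θ' 1 → normalLikelihood x θ' ≤ normalLikelihood x θ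

/-- The score: partial derivative in the `i`-th parameter of the log-density of the parametric
family `p`, at the parameter `θ` and the observation `x`. -/
def score {ι : Type*} [DecidableEq ι] (p : (ι → ℝ) → ℝ → ℝ) (θ : ι → ℝ) (i : ι) (x : ℝ) : ℝ :=
  deriv (fun t : ℝ => Real.log (p (Function.update θ i t) x)) (θ i)

/-- The Fisher information matrix (of one observation) of a parametric family `p` of Lebesgue
densities on the line: the second moments of the scores under the density `p θ`. -/
def fisherInformation {ι : Type*} [DecidableEq ι] (p : (ι → ℝ) → ℝ → ℝ) (θ : ι → ℝ) :
    Matrix ι ι ℝ :=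
  Matrix.of fun i j => ∫ x, score p θ i x * score p θ j x * p θ x

/-- The estimator `(1/n) ∑ xᵢ` of the mean. -/
def meanEstimator {n : ℕ} (x : Fin n → ℝ) : ℝ :=
  (∑ i, x i) / n

/-- The estimator `(1/n) ∑ (xᵢ - mean)²` of the variance. -/
def varEstimator {n : ℕ} (x : Fin n → ℝ) : ℝ :=
  (∑ i, (x i - meanEstimator x) ^ 2) / n

/-- The normal-theory standard error of `varEstimator`: the square root of the variance entry of
the inverse Fisher information of the normal model at the estimated parameter, divided by the
sample size. -/
def normalTheorySE {n : ℕ} (x : Fin n → ℝ) : ℝ :=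
  √((fisherInformation normalDensity ![meanEstimator x, varEstimator x])⁻¹ 1 1 / n)

/-- Excess kurtosis: the standardized fourth central moment minus three. -/
def excessKurtosis {Ω : Type*} [MeasurableSpace Ω] (X : Ω → ℝ) (P : Measure Ω) : ℝ :=
  centralMoment X 4 P / variance X P ^ 2 - 3

/-- The sample of the first `n` observations. -/
def firstObs {Ω : Type*} (X : ℕ → Ω → ℝ) (n : ℕ) (ω : Ω) : Fin n → ℝ :=
  fun i => X i ω

end

/-! Centre at the true mean: with `Y i = X i - μ`, the variance estimator is `A n - B n`, where `A
n` averages the `Y i ^ 2` and `B n` is the square of the average of the `Y i`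
(`varEstimator_firstObs`). `A n` is an i.i.d. average, so the central limit theorem applies to it,
with variance `Var (Y 0 ^ 2) = E[Y 0 ^ 4] - σ ^ 4 = σ ^ 4 * (κ + 2)`. `B n` is negligible in both
senses needed: `√n * B n` tends to 0 in `L¹`, which settles convergence in distribution, and `E[B n
^ 2]` is `O(n⁻²)` by the fourth moment of a centred sum, which settles the variance
(`tendsto_mul_variance_sub`).

The Fisher information comes from Gaussian moments and makes the normal-theory standard error
exactly `√2 / √n` times the estimator (`normalTheorySE_eq`). Its mean therefore differs from the
true standard deviation by order `1 / √n` when `κ ≠ 0`, while its variance is `O(n⁻²)`; Chebyshev's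
inequality (`tendsto_measure_abs_sub_lt`) turns the gap in means into a gap with probability tending
to one. -/

/-! ### Central moments of the Gaussian density -/

section GaussianMoments

variable {m : ℝ} {v : NNReal}

lemma hasDerivAt_gaussianPDFReal (hv : v ≠ 0) (x : ℝ) :
    HasDerivAt (gaussianPDFReal m v) (-((x - m) / v) * gaussianPDFReal m v x) x := by
  have hv' : (v : ℝ) ≠ 0 := by exact_mod_cast hv
  have h : HasDerivAt (fun y : ℝ => -(y - m) ^ 2 / (2 * v)) (-((x - m) / v)) x := by
    refine ((((hasDerivAt_id x).sub_const m).pow 2).neg.div_const (2 * (v : ℝ))).congr_deriv ?_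
    simp
    field_simp
  rw [gaussianPDFReal_def]
  refine (h.exp.const_mul (√(2 * Real.pi * v))⁻¹).congr_deriv ?_
  ring

lemma integrable_sub_pow_mul_gaussianPDFReal (hv : v ≠ 0) (k : ℕ) :
    Integrable (fun x => (x - m) ^ k * gaussianPDFReal m v x) := by
  have h1 : MemLp (fun x : ℝ => x - m) k (gaussianReal m v) :=
    (memLp_id_gaussianReal' (k : ENNReal) (by simp)).sub (memLp_const m)
  have h2 : Integrable (fun x : ℝ => (x - m) ^ k) (gaussianReal m v) := by
    refine (integrable_norm_iff (by fun_prop)).1 ?_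
    simpa [norm_pow] using h1.integrable_norm_pow'
  rw [gaussianReal_of_var_ne_zero _ hv] at h2
  have h3 := (integrable_withDensity_iff_integrable_smul' (measurable_gaussianPDF m v)
    (by simp [gaussianPDF])).1 h2
  refine h3.congr (ae_of_all _ fun x => ?_)
  simp [mul_comm]

lemma integral_sub_pow_mul_gaussianPDFReal_one (hv : v ≠ 0) :
    ∫ x, (x - m) ^ 1 * gaussianPDFReal m v x = 0 := by
  have hv' : (v : ℝ) ≠ 0 := by exact_mod_cast hv
  have h := integral_eq_zero_of_hasDerivAt_of_integrable (hasDerivAt_gaussianPDFReal (m := m) hv)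
    (((integrable_sub_pow_mul_gaussianPDFReal (m := m) hv 1).const_mul (-(1 / (v : ℝ)))).congr
      (ae_of_all _ fun x => by dsimp only; ring)) (integrable_gaussianPDFReal m v)
  have h2 : ∫ x, -((x - m) / v) * gaussianPDFReal m v x
      = -(1 / (v : ℝ)) * ∫ x, (x - m) ^ 1 * gaussianPDFReal m v x := by
    rw [← integral_const_mul]
    congr 1 with x
    ring
  rw [h2] at h
  simpa [hv'] using h

/-- Integration by parts: the derivative of `(x - m) ^ (k + 1)` times the density has integral zero.
-/
lemma integral_sub_pow_mul_gaussianPDFReal_add_two (hv : v ≠ 0) (k : ℕ) :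
    ∫ x, (x - m) ^ (k + 2) * gaussianPDFReal m v x
      = v * (k + 1) * ∫ x, (x - m) ^ k * gaussianPDFReal m v x := by
  have hv' : (v : ℝ) ≠ 0 := by exact_mod_cast hv
  have hd (x : ℝ) : HasDerivAt (fun y => (y - m) ^ (k + 1) * gaussianPDFReal m v y)
      ((k + 1) * ((x - m) ^ k * gaussianPDFReal m v x)
        - 1 / v * ((x - m) ^ (k + 2) * gaussianPDFReal m v x)) x := by
    refine ((((hasDerivAt_id x).sub_const m).pow (k + 1)).mul
      (hasDerivAt_gaussianPDFReal hv x)).congr_deriv ?_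
    simp
    ring
  have i1 := (integrable_sub_pow_mul_gaussianPDFReal (m := m) hv k).const_mul ((k : ℝ) + 1)
  have i2 := (integrable_sub_pow_mul_gaussianPDFReal (m := m) hv (k + 2)).const_mul (1 / (v : ℝ))
  have h := integral_eq_zero_of_hasDerivAt_of_integrable hd (i1.sub i2)
    (integrable_sub_pow_mul_gaussianPDFReal hv (k + 1))
  rw [integral_sub i1 i2, integral_const_mul, integral_const_mul] at h
  field_simp at h
  linarith

end GaussianMoments

/-! ### Scores and Fisher information of the normal model -/

section NormalModel

lemma log_normalDensity {m v : ℝ} (hv : 0 < v) (x : ℝ) :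
    Real.log (gaussianPDFReal m v.toNNReal x)
      = -(Real.log (2 * Real.pi * v) / 2) - (x - m) ^ 2 / (2 * v) := by
  have h : 0 < 2 * Real.pi * v := by positivity
  rw [gaussianPDFReal, Real.coe_toNNReal _ hv.le,
    Real.log_mul (by positivity) (Real.exp_ne_zero _), Real.log_inv, Real.log_sqrt h.le,
    Real.log_exp]
  ring

lemma score_normalDensity_zero {m v : ℝ} (hv : 0 < v) (x : ℝ) :
    score normalDensity ![m, v] 0 x = (x - m) / v := by
  unfold score normalDensity
  simp only [Function.update_self, Matrix.cons_val_zero, Matrix.cons_val_one, ne_eq, one_ne_zero,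
    not_false_eq_true, Function.update_of_ne, log_normalDensity hv]
  have h := ((((hasDerivAt_id m).const_sub x).pow 2).div_const (2 * v)).const_sub
    (-(Real.log (2 * Real.pi * v) / 2))
  refine (h.congr_deriv ?_).deriv
  simp
  field_simp

lemma score_normalDensity_one {m v : ℝ} (hv : 0 < v) (x : ℝ) :
    score normalDensity ![m, v] 1 x = (x - m) ^ 2 / (2 * v ^ 2) - 1 / (2 * v) := by
  unfold score normalDensity
  simp only [Function.update_self, Matrix.cons_val_zero, Matrix.cons_val_one, ne_eq, zero_ne_one,
    not_false_eq_true, Function.update_of_ne]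
  have h1 : HasDerivAt (fun t : ℝ => Real.log (2 * Real.pi * t)) (1 / v) v := by
    refine (((hasDerivAt_id v).const_mul (2 * Real.pi)).log (by positivity)).congr_deriv ?_
    simp
    field_simp
  have h2 : HasDerivAt (fun t : ℝ => (x - m) ^ 2 / (2 * t)) (-((x - m) ^ 2 / (2 * v ^ 2))) v := by
    refine ((hasDerivAt_const v ((x - m) ^ 2)).div ((hasDerivAt_id v).const_mul 2)
      (by simpa using hv.ne')).congr_deriv ?_
    simp
    field_simp
  have h := (h1.div_const 2).neg.sub h2
  -- The formula for the log-density needs a positive variance, so it is available only near `v`,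
  -- which is enough for a derivative.
  have heq : (fun t : ℝ => Real.log (gaussianPDFReal m t.toNNReal x)) =ᶠ[𝓝 v]
      fun t => -(Real.log (2 * Real.pi * t) / 2) - (x - m) ^ 2 / (2 * t) := by
    filter_upwards [lt_mem_nhds hv] with t ht using log_normalDensity ht x
  refine ((h.congr_deriv ?_).congr_of_eventuallyEq heq).deriv
  field_simp
  ring

lemma fisherInformation_normalDensity {m v : ℝ} (hv : 0 < v) :
    fisherInformation normalDensity ![m, v] = !![1 / v, 0; 0, 1 / (2 * v ^ 2)] := by
  have hw : v.toNNReal ≠ 0 := by simpa using hv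
  have hc : ((v.toNNReal : NNReal) : ℝ) = v := Real.coe_toNNReal _ hv.le
  have m0 : ∫ x, (x - m) ^ 0 * gaussianPDFReal m v.toNNReal x = 1 := by
    simpa using integral_gaussianPDFReal_eq_one m hw
  have m1 := integral_sub_pow_mul_gaussianPDFReal_one (m := m) hw
  have m2 := integral_sub_pow_mul_gaussianPDFReal_add_two (m := m) hw 0
  have m3 := integral_sub_pow_mul_gaussianPDFReal_add_two (m := m) hw 1
  have m4 := integral_sub_pow_mul_gaussianPDFReal_add_two (m := m) hw 2
  rw [m0, hc] at m2
  rw [m1] at m3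
  have I := fun k => integrable_sub_pow_mul_gaussianPDFReal (m := m) hw k
  have lin (a b c : ℝ) (i j k : ℕ) :
      ∫ x, (a * ((x - m) ^ i * gaussianPDFReal m v.toNNReal x)
        + b * ((x - m) ^ j * gaussianPDFReal m v.toNNReal x)
        + c * ((x - m) ^ k * gaussianPDFReal m v.toNNReal x))
      = a * (∫ x, (x - m) ^ i * gaussianPDFReal m v.toNNReal x)
        + b * (∫ x, (x - m) ^ j * gaussianPDFReal m v.toNNReal x)
        + c * ∫ x, (x - m) ^ k * gaussianPDFReal m v.toNNReal x := by
    have hij : Integrable (fun x => a * ((x - m) ^ i * gaussianPDFReal m v.toNNReal x)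
        + b * ((x - m) ^ j * gaussianPDFReal m v.toNNReal x)) :=
      ((I i).const_mul a).add ((I j).const_mul b)
    rw [integral_add hij ((I k).const_mul c),
      integral_add ((I i).const_mul a) ((I j).const_mul b), integral_const_mul,
      integral_const_mul, integral_const_mul]
  -- The off-diagonal entries involve only the first and third central moments, which vanish; the
  -- term with coefficient 0 merely fits the shape of `lin`.
  have e01 : ∫ x, (x - m) / v * ((x - m) ^ 2 / (2 * v ^ 2) - 1 / (2 * v))
      * gaussianPDFReal m v.toNNReal x = 0 := by
    trans ∫ x, (1 / (2 * v ^ 3) * ((x - m) ^ 3 * gaussianPDFReal m v.toNNReal x)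
        + -(1 / (2 * v ^ 2)) * ((x - m) ^ 1 * gaussianPDFReal m v.toNNReal x)
        + 0 * ((x - m) ^ 0 * gaussianPDFReal m v.toNNReal x))
    · congr 1 with x
      field_simp
      ring
    · rw [lin, m1, m3]
      ring
  ext i j
  fin_cases i <;> fin_cases j
  · simp only [fisherInformation, normalDensity, score_normalDensity_zero hv, Matrix.of_apply,
      Fin.zero_eta, Matrix.cons_val_zero, Matrix.cons_val_one]
    trans ∫ x, 1 / v ^ 2 * ((x - m) ^ 2 * gaussianPDFReal m v.toNNReal x)
    · congr 1 with x
      field_simp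
    · rw [integral_const_mul, m2]
      simp
      field_simp
  · simpa [fisherInformation, normalDensity, score_normalDensity_zero hv,
      score_normalDensity_one hv] using e01
  · simpa [fisherInformation, normalDensity, score_normalDensity_zero hv,
      score_normalDensity_one hv, mul_comm] using e01
  · simp only [fisherInformation, normalDensity, score_normalDensity_one hv, Matrix.of_apply,
      Fin.mk_one, Matrix.cons_val_zero, Matrix.cons_val_one]
    trans ∫ x, (1 / (4 * v ^ 4) * ((x - m) ^ 4 * gaussianPDFReal m v.toNNReal x)
        + -(1 / (2 * v ^ 3)) * ((x - m) ^ 2 * gaussianPDFReal m v.toNNReal x)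
        + 1 / (4 * v ^ 2) * ((x - m) ^ 0 * gaussianPDFReal m v.toNNReal x))
    · congr 1 with x
      field_simp
      ring
    · rw [lin, m4, m2, m0, hc]
      simp
      field_simp
      ring

lemma inv_fisherInformation_normalDensity {m v : ℝ} (hv : 0 < v) :
    (fisherInformation normalDensity ![m, v])⁻¹ = !![v, 0; 0, 2 * v ^ 2] := by
  rw [fisherInformation_normalDensity hv]
  refine Matrix.inv_eq_right_inv ?_
  ext i j
  fin_cases i <;> fin_cases j <;> simp [Matrix.mul_apply, Fin.sum_univ_two, hv.ne']
  field_simp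

/-- At variance 0 `gaussianPDFReal` is identically 0. The inverse of the zero matrix is again 0, so
a constant sample gets standard error 0. -/
lemma fisherInformation_normalDensity_zero (m : ℝ) :
    fisherInformation normalDensity ![m, 0] = 0 := by
  ext i j
  simp [fisherInformation, normalDensity]

lemma varEstimator_nonneg {n : ℕ} (x : Fin n → ℝ) : 0 ≤ varEstimator x := by
  unfold varEstimator
  positivity

lemma normalTheorySE_eq {n : ℕ} (x : Fin n → ℝ) :
    normalTheorySE x = √2 / √n * varEstimator x := by
  unfold normalTheorySE
  rcases (varEstimator_nonneg x).eq_or_lt' with h | h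
  · rw [h, fisherInformation_normalDensity_zero]
    simp
  · rw [inv_fisherInformation_normalDensity h]
    simp [Real.sqrt_sq h.le]
    ring

end NormalModel

/-! ### Maximum likelihood in the normal model -/

section MaximumLikelihood

variable {n : ℕ} {x : Fin n → ℝ}

lemma sum_sub_sq_eq (hn : n ≠ 0) (m : ℝ) :
    ∑ i, (x i - m) ^ 2 = n * (varEstimator x + (meanEstimator x - m) ^ 2) := by
  have hn' : (n : ℝ) ≠ 0 := by exact_mod_cast hn
  have h1 : ∑ i, x i = n * meanEstimator x := by
    unfold meanEstimator
    field_simp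
  have h2 : ∑ i, (x i - meanEstimator x) ^ 2 = n * varEstimator x := by
    unfold varEstimator
    field_simp
  have h3 (i : Fin n) : (x i - m) ^ 2 = (x i - meanEstimator x) ^ 2
      + 2 * (meanEstimator x - m) * x i
      - 2 * (meanEstimator x - m) * meanEstimator x + (meanEstimator x - m) ^ 2 := by
    ring
  simp_rw [h3]
  rw [Finset.sum_add_distrib, Finset.sum_sub_distrib, Finset.sum_add_distrib, h2,
    ← Finset.mul_sum, h1]
  simp
  ring

lemma normalLikelihood_pos {θ : Fin 2 → ℝ} (hθ : 0 < θ 1) : 0 < normalLikelihood x θ :=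
  Finset.prod_pos fun _ _ => gaussianPDFReal_pos _ _ _ (by simpa using hθ)

lemma log_normalLikelihood (hn : n ≠ 0) {θ : Fin 2 → ℝ} (hθ : 0 < θ 1) :
    Real.log (normalLikelihood x θ) = -(n / 2) * (Real.log (2 * Real.pi) + Real.log (θ 1)
      + (varEstimator x + (meanEstimator x - θ 0) ^ 2) / θ 1) := by
  unfold normalLikelihood normalDensity
  rw [Real.log_prod fun i _ => (gaussianPDFReal_pos _ _ _ (by simpa using hθ)).ne']
  simp_rw [log_normalDensity hθ]
  rw [Finset.sum_sub_distrib, ← Finset.sum_div, sum_sub_sq_eq hn,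
    Real.log_mul (by positivity) hθ.ne']
  simp
  field_simp
  ring

/-- After taking logarithms this is `log t < t - 1` for the ratio `t ≠ 1` of estimated to candidate
variance. If `t = 1`, the means differ and their squared distance gives strictness. -/
lemma normalLikelihood_lt (hx : 0 < varEstimator x) {θ : Fin 2 → ℝ} (hθ : 0 < θ 1)
    (hne : θ ≠ ![meanEstimator x, varEstimator x]) :
    normalLikelihood x θ < normalLikelihood x ![meanEstimator x, varEstimator x] := by
  have hn : n ≠ 0 := by
    rintro rfl
    simp [varEstimator] at hx
  have hn' : (0 : ℝ) < n := by positivity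
  refine (Real.log_lt_log_iff (normalLikelihood_pos hθ) (normalLikelihood_pos (by simpa))).1 ?_
  rw [log_normalLikelihood hn hθ, log_normalLikelihood hn (by simpa)]
  simp only [Matrix.cons_val_one, Matrix.cons_val_zero, sub_self, ne_eq, OfNat.ofNat_ne_zero,
    not_false_eq_true, zero_pow, add_zero, div_self hx.ne', add_div]
  have hlog := Real.log_div hx.ne' hθ.ne'
  have hd : 0 ≤ (meanEstimator x - θ 0) ^ 2 / θ 1 := by positivity
  have key : Real.log (varEstimator x) + 1 < Real.log (θ 1)
      + (varEstimator x / θ 1 + (meanEstimator x - θ 0) ^ 2 / θ 1) := by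
    by_cases h1 : θ 1 = varEstimator x
    · have h0 : meanEstimator x - θ 0 ≠ 0 := by
        intro h0
        refine hne ?_
        ext i
        fin_cases i
        · simp; linarith
        · simpa using h1
      have : 0 < (meanEstimator x - θ 0) ^ 2 / θ 1 := by positivity
      rw [h1, div_self hx.ne'] at *
      linarith
    · have := Real.log_lt_sub_one_of_pos (div_pos hx hθ) fun h => h1 ((div_eq_one_iff_eq
        hθ.ne').1 h).symm
      linarith
  nlinarith

lemma isNormalMLE_iff (hx : 0 < varEstimator x) (θ : Fin 2 → ℝ) :
    IsNormalMLE x θ ↔ θ = ![meanEstimator x, varEstimator x] := by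
  constructor
  · rintro ⟨hθ, hmax⟩
    by_contra hne
    exact (normalLikelihood_lt hx hθ hne).not_ge (hmax _ (by simpa))
  · rintro rfl
    refine ⟨by simpa, fun θ hθ => ?_⟩
    by_cases h : θ = ![meanEstimator x, varEstimator x]
    · rw [h]
    · exact (normalLikelihood_lt hx hθ h).le

end MaximumLikelihood

/-! ### Moments of sums of independent variables -/

section FourthMoment

variable {Ω : Type*} [MeasurableSpace Ω] {P : Measure Ω} [IsProbabilityMeasure P]

lemma MemLp.integrable_pow_of_le {f : Ω → ℝ} {p : ℕ} (hf : MemLp f p P) {k : ℕ} (hk : k ≤ p) :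
    Integrable (fun ω => f ω ^ k) P := by
  have h : MemLp f k P := hf.mono_exponent (by exact_mod_cast hk)
  refine (integrable_norm_iff (h.1.pow k)).1 ?_
  simpa [norm_pow] using h.integrable_norm_pow'

lemma MemLp.sq_of_four {f : Ω → ℝ} (hf : MemLp f 4 P) : MemLp (fun ω => f ω ^ 2) 2 P := by
  refine (memLp_two_iff_integrable_sq (hf.1.pow 2)).2 ?_
  simpa [← pow_mul] using MemLp.integrable_pow_of_le (p := 4) (by simpa using hf) le_rfl

lemma IndepFun.integral_add_pow_four {U V : Ω → ℝ} (h : IndepFun U V P) (hU : MemLp U 4 P)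
    (hV : MemLp V 4 P) (hU0 : ∫ ω, U ω ∂P = 0) (hV0 : ∫ ω, V ω ∂P = 0) :
    ∫ ω, (U ω + V ω) ^ 4 ∂P = ∫ ω, U ω ^ 4 ∂P
      + 6 * ((∫ ω, U ω ^ 2 ∂P) * ∫ ω, V ω ^ 2 ∂P) + ∫ ω, V ω ^ 4 ∂P := by
  have iU {k : ℕ} (hk : k ≤ 4) := MemLp.integrable_pow_of_le (p := 4) (by simpa using hU) hk
  have iV {k : ℕ} (hk : k ≤ 4) := MemLp.integrable_pow_of_le (p := 4) (by simpa using hV) hk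
  have hij (i j : ℕ) : IndepFun (fun ω => U ω ^ i) (fun ω => V ω ^ j) P :=
    h.comp (φ := fun x => x ^ i) (ψ := fun x => x ^ j) (by fun_prop) (by fun_prop)
  have iUV {i j : ℕ} (hi : i ≤ 4) (hj : j ≤ 4) : Integrable (fun ω => U ω ^ i * V ω ^ j) P :=
    (hij i j).integrable_mul (iU hi) (iV hj)
  have eUV {i j : ℕ} (hi : i ≤ 4) (hj : j ≤ 4) :
      ∫ ω, U ω ^ i * V ω ^ j ∂P = (∫ ω, U ω ^ i ∂P) * ∫ ω, V ω ^ j ∂P :=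
    (hij i j).integral_fun_mul_eq_mul_integral (iU hi).1 (iV hj).1
  have hexp : ∫ ω, (U ω + V ω) ^ 4 ∂P = ∫ ω, (U ω ^ 4 + (4 * (U ω ^ 3 * V ω ^ 1)
      + (6 * (U ω ^ 2 * V ω ^ 2) + (4 * (U ω ^ 1 * V ω ^ 3) + V ω ^ 4)))) ∂P := by
    congr 1 with ω
    ring
  have i4 : Integrable (fun ω => 4 * (U ω ^ 1 * V ω ^ 3) + V ω ^ 4) P :=
    ((iUV (by simp) (by simp)).const_mul 4).add (iV le_rfl)
  have i3 : Integrable (fun ω => 6 * (U ω ^ 2 * V ω ^ 2) + (4 * (U ω ^ 1 * V ω ^ 3) + V ω ^ 4)) P :=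
    ((iUV (by simp) (by simp)).const_mul 6).add i4
  have i2 : Integrable (fun ω => 4 * (U ω ^ 3 * V ω ^ 1)
      + (6 * (U ω ^ 2 * V ω ^ 2) + (4 * (U ω ^ 1 * V ω ^ 3) + V ω ^ 4))) P :=
    ((iUV (by simp) (by simp)).const_mul 4).add i3
  rw [hexp, integral_add (iU le_rfl) i2,
    integral_add ((iUV (by simp) (by simp)).const_mul 4) i3,
    integral_add ((iUV (by simp) (by simp)).const_mul 6) i4,
    integral_add ((iUV (by simp) (by simp)).const_mul 4) (iV le_rfl),
    integral_const_mul, integral_const_mul, integral_const_mul,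
    eUV (by simp) (by simp), eUV (by simp) (by simp), eUV (by simp) (by simp)]
  simp only [pow_one, hU0, hV0]
  ring

variable {Y : ℕ → Ω → ℝ}

omit [IsProbabilityMeasure P] in
lemma memLp_sum_range {p : ENNReal} (hident : ∀ i, IdentDistrib (Y i) (Y 0) P P)
    (hmom : MemLp (Y 0) p P) (n : ℕ) : MemLp (fun ω => ∑ i ∈ Finset.range n, Y i ω) p P :=
  memLp_finsetSum _ fun i _ => (hident i).memLp_iff.2 hmom

omit [IsProbabilityMeasure P] in
lemma integral_sum_range (hident : ∀ i, IdentDistrib (Y i) (Y 0) P P)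
    (hint : Integrable (Y 0) P) (n : ℕ) :
    ∫ ω, ∑ i ∈ Finset.range n, Y i ω ∂P = n * ∫ ω, Y 0 ω ∂P := by
  rw [integral_finsetSum _ fun i _ => (hident i).integrable_iff.2 hint]
  simp [(hident _).integral_eq]

omit [IsProbabilityMeasure P] in
lemma variance_sum_range (hindep : iIndepFun Y P) (hident : ∀ i, IdentDistrib (Y i) (Y 0) P P)
    (hmom : MemLp (Y 0) 2 P) (n : ℕ) :
    variance (fun ω => ∑ i ∈ Finset.range n, Y i ω) P = n * variance (Y 0) P := by
  have h := IndepFun.variance_sum (s := Finset.range n)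
    (fun i _ => (hident i).memLp_iff.2 hmom) fun i _ j _ hij => hindep.indepFun hij
  simp only [(hident _).variance_eq, Finset.sum_const, Finset.card_range, nsmul_eq_mul] at h
  rw [← h]
  congr 1
  ext ω
  simp

/-- Induction on `n`, splitting off the last summand; mixed terms with a first power vanish, and
`3n(n - 1) + 6n = 3(n + 1)n`. Only the `O(n²)` growth matters later. -/
lemma integral_sum_range_pow_four (hindep : iIndepFun Y P)
    (hident : ∀ i, IdentDistrib (Y i) (Y 0) P P) (hmom : MemLp (Y 0) 4 P)
    (hmean : ∫ ω, Y 0 ω ∂P = 0) (n : ℕ) :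
    ∫ ω, (∑ i ∈ Finset.range n, Y i ω) ^ 4 ∂P
      = n * ∫ ω, Y 0 ω ^ 4 ∂P + 3 * n * (n - 1) * (∫ ω, Y 0 ω ^ 2 ∂P) ^ 2 := by
  have hmom2 : MemLp (Y 0) 2 P := hmom.mono_exponent (by norm_num)
  have hint : Integrable (Y 0) P := hmom.integrable (by norm_num)
  have hS0 (n : ℕ) : ∫ ω, ∑ i ∈ Finset.range n, Y i ω ∂P = 0 := by
    rw [integral_sum_range hident hint, hmean, mul_zero]
  induction n with
  | zero => simp
  | succ n ih =>
    have hI : IndepFun (fun ω => ∑ i ∈ Finset.range n, Y i ω) (Y n) P := by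
      have := hindep.indepFun_finsetSum_of_notMem₀ (fun i => (hident i).aemeasurable_fst)
        (Finset.notMem_range_self (n := n))
      convert this using 1
      ext ω
      simp
    have hS2 : ∫ ω, (∑ i ∈ Finset.range n, Y i ω) ^ 2 ∂P = n * ∫ ω, Y 0 ω ^ 2 ∂P := by
      rw [← variance_of_integral_eq_zero (memLp_sum_range hident hmom n).aemeasurable (hS0 n),
        ← variance_of_integral_eq_zero hmom.aemeasurable hmean,
        variance_sum_range hindep hident hmom2]
    have hpow (k : ℕ) : ∫ ω, Y n ω ^ k ∂P = ∫ ω, Y 0 ω ^ k ∂P :=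
      ((hident n).comp (u := fun x => x ^ k) (by fun_prop)).integral_eq
    simp_rw [Finset.sum_range_succ]
    rw [IndepFun.integral_add_pow_four hI (memLp_sum_range hident hmom n)
      ((hident n).memLp_iff.2 hmom) (hS0 n) ((hident n).integral_eq.trans hmean), ih, hS2, hpow,
      hpow]
    push_cast
    ring

end FourthMoment

/-! ### Variance under a negligible perturbation -/

section Variance

variable {Ω : Type*} [MeasurableSpace Ω] {P : Measure Ω} [IsProbabilityMeasure P]

/-- A weighted Cauchy–Schwarz inequality: both `c • A + B` and `c • A - B` have nonnegative
variance. -/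
lemma two_mul_mul_abs_covariance_le {A B : Ω → ℝ} (hA : MemLp A 2 P) (hB : MemLp B 2 P) (c : ℝ) :
    2 * c * |cov[A, B; P]| ≤ c ^ 2 * variance A P + variance B P := by
  have h1 := variance_nonneg (c • A + B) P
  have h2 := variance_nonneg (c • A - B) P
  rw [variance_add (hA.const_smul c) hB, variance_smul, covariance_smul_left] at h1
  rw [variance_sub (hA.const_smul c) hB, variance_smul, covariance_smul_left] at h2
  rcases abs_cases (cov[A, B; P]) with ⟨h, -⟩ | ⟨h, -⟩ <;> rw [h] <;> linarith

lemma tendsto_mul_variance_sub {A B : ℕ → Ω → ℝ} (hA : ∀ n, MemLp (A n) 2 P)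
    (hB : ∀ n, MemLp (B n) 2 P) {a C : ℝ}
    (hVA : Tendsto (fun n : ℕ => n * variance (A n) P) atTop (𝓝 a))
    (hVB : ∀ n : ℕ, (n : ℝ) ^ 2 * variance (B n) P ≤ C) :
    Tendsto (fun n : ℕ => n * variance (A n - B n) P) atTop (𝓝 a) := by
  have hs : Tendsto (fun n : ℕ => (√(n : ℝ))⁻¹) atTop (𝓝 0) :=
    tendsto_inv_atTop_zero.comp (Real.tendsto_sqrt_atTop.comp tendsto_natCast_atTop_atTop)
  have hi : Tendsto (fun n : ℕ => (n : ℝ)⁻¹) atTop (𝓝 0) := tendsto_inv_atTop_nhds_zero_nat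
  have hb0 : Tendsto (fun n : ℕ => n * variance (B n) P) atTop (𝓝 0) := by
    have hlim : Tendsto (fun n : ℕ => (n : ℝ)⁻¹ * C) atTop (𝓝 0) := by
      simpa using hi.mul_const C
    refine squeeze_zero' (.of_forall fun n =>
      mul_nonneg n.cast_nonneg (variance_nonneg _ _)) ?_ hlim
    filter_upwards [eventually_ne_atTop 0] with n hn
    refine le_of_eq_of_le ?_ (mul_le_mul_of_nonneg_left (hVB n) (by positivity))
    field_simp
  have hc0 : Tendsto (fun n : ℕ => n * (2 * cov[A n, B n; P])) atTop (𝓝 0) := by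
    have hlim : Tendsto (fun n : ℕ => (√(n : ℝ))⁻¹ * (n * variance (A n) P + C)) atTop (𝓝 0) := by
      simpa using hs.mul (hVA.add_const C)
    refine squeeze_zero_norm' ?_ hlim
    filter_upwards [eventually_ne_atTop 0] with n hn
    have hn' : (0 : ℝ) < n := by positivity
    have hr : 0 < √(n : ℝ) := Real.sqrt_pos.2 hn'
    have hsq : √(n : ℝ) ^ 2 = n := Real.sq_sqrt hn'.le
    -- The weight `1 / √n` balances `Var (A n)`, of order `1 / n`, against `Var (B n)`, of order `1
    -- / n²`: the rescaled covariance is `O(1 / √n)`.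
    have h := mul_le_mul_of_nonneg_left (two_mul_mul_abs_covariance_le (hA n) (hB n) (√(n : ℝ))⁻¹)
      (by positivity : 0 ≤ √(n : ℝ) * n)
    have h' := mul_le_mul_of_nonneg_left (hVB n) (inv_nonneg.2 hr.le)
    rw [Real.norm_eq_abs, abs_mul, abs_mul, abs_two, Nat.abs_cast]
    have e1 : √(n : ℝ) * n * (2 * (√(n : ℝ))⁻¹ * |cov[A n, B n; P]|)
        = n * (2 * |cov[A n, B n; P]|) := by
      field_simp
    have e2 : √(n : ℝ) * n * ((√(n : ℝ))⁻¹ ^ 2 * variance (A n) P + variance (B n) P)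
        = (√(n : ℝ))⁻¹ * (n * variance (A n) P + (n : ℝ) ^ 2 * variance (B n) P) := by
      field_simp
      rw [hsq]
    linarith
  have h := (hVA.sub hc0).add hb0
  rw [sub_zero, add_zero] at h
  refine h.congr fun n => ?_
  rw [variance_sub (hA n) (hB n)]
  ring

end Variance

/-! ### Mean, variance and limit law of the variance estimator -/

section SampleVariance

variable {Ω : Type*} [MeasurableSpace Ω] {P : Measure Ω} [IsProbabilityMeasure P]
  {X : ℕ → Ω → ℝ} {m : ℝ}

omit [MeasurableSpace Ω] in
-- The centre `m` is arbitrary: 0 suffices for integrability, the true mean is used for the limits.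
lemma varEstimator_firstObs (X : ℕ → Ω → ℝ) (m : ℝ) (n : ℕ) (ω : Ω) :
    varEstimator (firstObs X n ω) = (∑ i ∈ Finset.range n, (X i ω - m) ^ 2) / n
      - ((∑ i ∈ Finset.range n, (X i ω - m)) / n) ^ 2 := by
  rcases eq_or_ne n 0 with rfl | hn
  · simp [varEstimator]
  have hn' : (n : ℝ) ≠ 0 := by exact_mod_cast hn
  have h1 := sum_sub_sq_eq (x := firstObs X n ω) hn m
  have h2 : meanEstimator (firstObs X n ω) - m = (∑ i ∈ Finset.range n, (X i ω - m)) / n := by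
    rw [Finset.sum_sub_distrib, ← Fin.sum_univ_eq_sum_range (fun i => X i ω)]
    simp only [meanEstimator, firstObs, Finset.sum_const, Finset.card_range, nsmul_eq_mul]
    field_simp
  rw [← h2, ← Fin.sum_univ_eq_sum_range (fun i => (X i ω - m) ^ 2)]
  simp only [firstObs] at h1 ⊢
  rw [h1]
  field_simp
  ring

lemma memLp_sum_sq_div (hident : ∀ i, IdentDistrib (X i) (X 0) P P) (hmom : MemLp (X 0) 4 P)
    (n : ℕ) : MemLp (fun ω => (∑ i ∈ Finset.range n, (X i ω - m) ^ 2) / n) 2 P := by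
  simp_rw [div_eq_inv_mul]
  have h (i : ℕ) : MemLp (fun ω => X i ω - m) 4 P :=
    ((hident i).memLp_iff.2 hmom).sub (memLp_const m)
  have hs : MemLp (fun ω => ∑ i ∈ Finset.range n, (X i ω - m) ^ 2) 2 P :=
    memLp_finsetSum _ fun i _ => MemLp.sq_of_four (h i)
  exact hs.const_mul _

lemma memLp_sq_sum_div (hident : ∀ i, IdentDistrib (X i) (X 0) P P) (hmom : MemLp (X 0) 4 P)
    (n : ℕ) : MemLp (fun ω => ((∑ i ∈ Finset.range n, (X i ω - m)) / n) ^ 2) 2 P := by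
  simp_rw [div_eq_inv_mul]
  have h (i : ℕ) : MemLp (fun ω => X i ω - m) 4 P :=
    ((hident i).memLp_iff.2 hmom).sub (memLp_const m)
  have hs : MemLp (fun ω => ∑ i ∈ Finset.range n, (X i ω - m)) 4 P :=
    memLp_finsetSum _ fun i _ => h i
  exact MemLp.sq_of_four (hs.const_mul (n : ℝ)⁻¹)

lemma memLp_varEstimator (hident : ∀ i, IdentDistrib (X i) (X 0) P P) (hmom : MemLp (X 0) 4 P)
    (n : ℕ) : MemLp (fun ω => varEstimator (firstObs X n ω)) 2 P := by
  simp_rw [varEstimator_firstObs X 0]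
  exact (memLp_sum_sq_div hident hmom n).sub (memLp_sq_sum_div hident hmom n)

omit [IsProbabilityMeasure P] in
lemma identDistrib_sub_sq (hident : ∀ i, IdentDistrib (X i) (X 0) P P) (m : ℝ) (i : ℕ) :
    IdentDistrib (fun ω => (X i ω - m) ^ 2) (fun ω => (X 0 ω - m) ^ 2) P P :=
  (hident i).comp (u := fun x => (x - m) ^ 2) (by fun_prop)

omit [IsProbabilityMeasure P] in
lemma iIndepFun_sub_sq (hindep : iIndepFun X P) (m : ℝ) :
    iIndepFun (fun i ω => (X i ω - m) ^ 2) P :=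
  hindep.comp (fun _ x => (x - m) ^ 2) (by fun_prop)

lemma integral_sq_sum_sub (hindep : iIndepFun X P) (hident : ∀ i, IdentDistrib (X i) (X 0) P P)
    (hmom : MemLp (X 0) 2 P) (hmean : ∫ ω, X 0 ω ∂P = m) (n : ℕ) :
    ∫ ω, (∑ i ∈ Finset.range n, (X i ω - m)) ^ 2 ∂P = n * variance (X 0) P := by
  have hindep' : iIndepFun (fun i ω => X i ω - m) P := hindep.comp (fun _ x => x - m) (by fun_prop)
  have hident' (i : ℕ) : IdentDistrib (fun ω => X i ω - m) (fun ω => X 0 ω - m) P P :=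
    (hident i).comp (u := fun x => x - m) (by fun_prop)
  have hmom' : MemLp (fun ω => X 0 ω - m) 2 P := hmom.sub (memLp_const m)
  have hmean' : ∫ ω, (X 0 ω - m) ∂P = 0 := by
    rw [integral_sub (hmom.integrable (by norm_num)) (integrable_const m), hmean]
    simp
  rw [← variance_of_integral_eq_zero (memLp_sum_range hident' hmom' n).aemeasurable,
    variance_sum_range hindep' hident' hmom', variance_sub_const hmom.1]
  rw [integral_sum_range hident' (hmom'.integrable (by norm_num)), hmean', mul_zero]

lemma integral_varEstimator (hindep : iIndepFun X P)
    (hident : ∀ i, IdentDistrib (X i) (X 0) P P) (hmom : MemLp (X 0) 4 P) {n : ℕ} (hn : n ≠ 0) :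
    ∫ ω, varEstimator (firstObs X n ω) ∂P = (1 - 1 / n) * variance (X 0) P := by
  have hn' : (n : ℝ) ≠ 0 := by exact_mod_cast hn
  have hmom2 : MemLp (X 0) 2 P := hmom.mono_exponent (by norm_num)
  simp_rw [varEstimator_firstObs X (∫ ω, X 0 ω ∂P)]
  rw [integral_sub ((memLp_sum_sq_div hident hmom n).integrable (by norm_num))
    ((memLp_sq_sum_div hident hmom n).integrable (by norm_num))]
  simp_rw [div_pow]
  rw [integral_div, integral_div, integral_sq_sum_sub hindep hident hmom2 rfl,
    integral_sum_range (Y := fun i ω => (X i ω - ∫ ω, X 0 ω ∂P) ^ 2) (identDistrib_sub_sq hident _)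
      (hmom2.sub (memLp_const _)).integrable_sq, ← variance_eq_integral hmom.aemeasurable]
  field_simp

lemma variance_sub_sq (hmom : MemLp (X 0) 4 P) (hmean : ∫ ω, X 0 ω ∂P = m) :
    variance (fun ω => (X 0 ω - m) ^ 2) P = centralMoment (X 0) 4 P - variance (X 0) P ^ 2 := by
  have h : MemLp (fun ω => X 0 ω - m) 4 P := hmom.sub (memLp_const m)
  rw [variance_eq_sub (MemLp.sq_of_four h), variance_eq_integral hmom.aemeasurable, centralMoment,
    hmean]
  simp [← pow_mul]

lemma tendsto_mul_variance_varEstimator (hindep : iIndepFun X P)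
    (hident : ∀ i, IdentDistrib (X i) (X 0) P P) (hmom : MemLp (X 0) 4 P) :
    Tendsto (fun n : ℕ => n * variance (fun ω => varEstimator (firstObs X n ω)) P) atTop
      (𝓝 (centralMoment (X 0) 4 P - variance (X 0) P ^ 2)) := by
  set m := ∫ ω, X 0 ω ∂P with hm
  have hY : MemLp (fun ω => X 0 ω - m) 4 P := hmom.sub (memLp_const m)
  have hA (n : ℕ) := memLp_sum_sq_div (m := m) hident hmom n
  have hB (n : ℕ) := memLp_sq_sum_div (m := m) hident hmom n
  have hVA : Tendsto (fun n : ℕ =>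
      n * variance (fun ω => (∑ i ∈ Finset.range n, (X i ω - m) ^ 2) / n) P) atTop
      (𝓝 (centralMoment (X 0) 4 P - variance (X 0) P ^ 2)) := by
    refine tendsto_const_nhds.congr' ?_
    filter_upwards [eventually_ne_atTop 0] with n hn
    simp_rw [div_eq_inv_mul]
    rw [variance_const_mul, variance_sum_range (Y := fun i ω => (X i ω - m) ^ 2)
      (iIndepFun_sub_sq hindep m) (identDistrib_sub_sq hident m) (MemLp.sq_of_four hY),
      variance_sub_sq hmom rfl]
    field_simp
  set c := ∫ ω, (X 0 ω - m) ^ 4 ∂P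
  set d := (∫ ω, (X 0 ω - m) ^ 2 ∂P) ^ 2
  -- The variance is at most the second moment, here the fourth moment of the centred sum over `n ^
  -- 4`.
  have hB4 (n : ℕ) : variance (fun ω => ((∑ i ∈ Finset.range n, (X i ω - m)) / n) ^ 2) P
      ≤ (n * c + 3 * n * (n - 1) * d) / n ^ 4 := by
    refine (variance_le_expectation_sq (hB n).1).trans_eq ?_
    have h4 := integral_sum_range_pow_four (Y := fun i ω => X i ω - m)
      (hindep.comp (fun _ x => x - m) (by fun_prop))
      (fun i => (hident i).comp (u := fun x => x - m) (by fun_prop)) hY (by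
        rw [integral_sub (hmom.integrable (by norm_num)) (integrable_const m), ← hm]
        simp) n
    rw [← h4, ← integral_div]
    congr 1 with ω
    simp only [Pi.pow_apply]
    ring
  have hc : 0 ≤ c := integral_nonneg fun ω => by positivity
  have hd : 0 ≤ d := sq_nonneg _
  have hVB (n : ℕ) : (n : ℝ) ^ 2
      * variance (fun ω => ((∑ i ∈ Finset.range n, (X i ω - m)) / n) ^ 2) P ≤ c + 3 * d := by
    rcases eq_or_ne n 0 with rfl | hn
    · rw [Nat.cast_zero, zero_pow two_ne_zero, zero_mul]
      linarith
    have hn1 : (1 : ℝ) ≤ n := by exact_mod_cast Nat.one_le_iff_ne_zero.2 hn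
    refine (mul_le_mul_of_nonneg_left (hB4 n) (by positivity)).trans ?_
    have e : (n : ℝ) ^ 2 * ((n * c + 3 * n * (n - 1) * d) / n ^ 4)
        = (c + 3 * (n - 1) * d) / n := by
      field_simp
    rw [e, div_le_iff₀ (by positivity)]
    nlinarith [mul_nonneg hc (sub_nonneg.2 hn1)]
  refine (tendsto_mul_variance_sub hA hB hVA hVB).congr fun n => ?_
  congr 2
  ext ω
  rw [varEstimator_firstObs X m]
  rfl

/-- Asymptotic normality of the variance estimator. -/
lemma tendstoInDistribution_varEstimator (hindep : iIndepFun X P)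
    (hident : ∀ i, IdentDistrib (X i) (X 0) P P) (hmom : MemLp (X 0) 4 P) :
    TendstoInDistribution
      (fun (n : ℕ) ω => √n * (varEstimator (firstObs X n ω) - variance (X 0) P)) atTop
      (id : ℝ → ℝ) (fun _ => P)
      (gaussianReal 0 (centralMoment (X 0) 4 P - variance (X 0) P ^ 2).toNNReal) := by
  set m := ∫ ω, X 0 ω ∂P with hm
  have hmom2 : MemLp (X 0) 2 P := hmom.mono_exponent (by norm_num)
  have hY : MemLp (fun ω => X 0 ω - m) 4 P := hmom.sub (memLp_const m)
  have hclt := tendstoInDistribution_inv_sqrt_mul_sum_sub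
    (X := fun i ω => (X i ω - m) ^ 2) (Y := (id : ℝ → ℝ))
    (P' := gaussianReal 0 (variance (fun ω => (X 0 ω - m) ^ 2) P).toNNReal)
    HasLaw.id (MemLp.sq_of_four hY) (iIndepFun_sub_sq hindep m) (identDistrib_sub_sq hident m)
  rw [← variance_eq_integral hmom.aemeasurable] at hclt
  rw [← variance_sub_sq hmom hm.symm]
  -- Slutsky: it remains to show that the remainder `-(√n * B n)` tends to 0 in measure. Its `L¹`
  -- norm is `variance (X 0) P / √n`.
  refine tendstoInDistribution_of_tendstoInMeasure_sub _ _ hclt ?_ fun n =>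
    ((memLp_varEstimator hident hmom n).aemeasurable.sub_const _).const_mul _
  have hdiff : (fun (n : ℕ) ω => √n * (varEstimator (firstObs X n ω) - variance (X 0) P))
      - (fun (n : ℕ) ω => (√n)⁻¹ * (∑ i ∈ Finset.range n, (X i ω - m) ^ 2 - n * variance (X 0) P))
      = fun (n : ℕ) ω => -(√n * ((∑ i ∈ Finset.range n, (X i ω - m)) / n) ^ 2) := by
    ext n ω
    simp only [Pi.sub_apply]
    rcases eq_or_ne n 0 with rfl | hn
    · simp
    rw [varEstimator_firstObs X m]
    have hr : √(n : ℝ) ≠ 0 := by positivity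
    have hsq : √(n : ℝ) ^ 2 = n := Real.sq_sqrt n.cast_nonneg
    field_simp
    rw [hsq]
    ring
  rw [hdiff]
  have hR (n : ℕ) : MemLp (fun ω => √n * ((∑ i ∈ Finset.range n, (X i ω - m)) / n) ^ 2) 2 P :=
    (memLp_sq_sum_div hident hmom n).const_mul _
  have hE (n : ℕ) : ∫ ω, √n * ((∑ i ∈ Finset.range n, (X i ω - m)) / n) ^ 2 ∂P
      = variance (X 0) P * (√n)⁻¹ := by
    rcases eq_or_ne n 0 with rfl | hn
    · simp
    simp_rw [div_pow]
    rw [integral_const_mul, integral_div, integral_sq_sum_sub hindep hident hmom2 hm.symm]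
    have hr : √(n : ℝ) ≠ 0 := by positivity
    have hsq : √(n : ℝ) ^ 2 = n := Real.sq_sqrt n.cast_nonneg
    field_simp
    rw [hsq]
  refine tendstoInMeasure_of_tendsto_eLpNorm one_ne_zero (fun n => (hR n).1.neg)
    aestronglyMeasurable_const ?_
  have hnorm (n : ℕ) : eLpNorm ((fun ω => -(√n * ((∑ i ∈ Finset.range n, (X i ω - m)) / n) ^ 2))
      - (0 : Ω → ℝ)) 1 P = ENNReal.ofReal (variance (X 0) P * (√n)⁻¹) := by
    rw [sub_zero, eLpNorm_one_eq_lintegral_enorm, ← hE,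
      ofReal_integral_eq_lintegral_ofReal ((hR n).integrable (by norm_num))
        (.of_forall fun ω => by positivity)]
    refine lintegral_congr fun ω => ?_
    rw [enorm_neg, Real.enorm_of_nonneg (by positivity)]
  simp_rw [hnorm]
  have hs : Tendsto (fun n : ℕ => (√(n : ℝ))⁻¹) atTop (𝓝 0) :=
    tendsto_inv_atTop_zero.comp (Real.tendsto_sqrt_atTop.comp tendsto_natCast_atTop_atTop)
  simpa using ENNReal.tendsto_ofReal (hs.const_mul (variance (X 0) P))

end SampleVariance

/-! ### Chebyshev's inequality at scale `1 / √n` -/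

section Concentration

variable {Ω : Type*} [MeasurableSpace Ω] {P : Measure Ω} [IsProbabilityMeasure P]

/-- If the rescaled variances `n Var(Sₙ)` vanish, then deviations of `Sₙ` from its mean are
negligible compared with gaps of order `1 / √n`. -/
lemma tendsto_measure_abs_sub_lt {S : ℕ → Ω → ℝ} (hS : ∀ n, MemLp (S n) 2 P)
    (hV : Tendsto (fun n : ℕ => n * variance (S n) P) atTop (𝓝 0)) {gap : ℕ → ℝ} {δ : ℝ}
    (hδ : 0 < δ) (hgap : Tendsto (fun n : ℕ => √n * gap n) atTop (𝓝 δ)) :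
    Tendsto (fun n => P {ω | |S n ω - ∫ ω', S n ω' ∂P| < gap n}) atTop (𝓝 1) := by
  have hlim : Tendsto (fun n : ℕ => 1 - ENNReal.ofReal (n * variance (S n) P / (√n * gap n) ^ 2))
      atTop (𝓝 1) := by
    have h := ENNReal.Tendsto.sub (tendsto_const_nhds (x := (1 : ENNReal)))
      (ENNReal.tendsto_ofReal (hV.div (hgap.pow 2) (by positivity))) (by simp)
    simpa using h
  refine tendsto_of_tendsto_of_tendsto_of_le_of_le' hlim tendsto_const_nhds ?_
    (.of_forall fun n => prob_le_one)
  filter_upwards [hgap.eventually_const_lt hδ, eventually_ne_atTop 0] with n hn hn0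
  have hr : 0 < √(n : ℝ) := by positivity
  have hsq : √(n : ℝ) ^ 2 = n := Real.sq_sqrt n.cast_nonneg
  have hg : 0 < gap n := by
    by_contra! h
    exact hn.not_ge (mul_nonpos_of_nonneg_of_nonpos hr.le h)
  have hcheb := meas_ge_le_variance_div_sq (hS n) hg
  -- Multiplying numerator and denominator of Chebyshev's bound by `n` gives a quotient tending to
  -- `0 / δ ^ 2`.
  have e : n * variance (S n) P / (√n * gap n) ^ 2 = variance (S n) P / gap n ^ 2 := by
    rw [mul_pow, hsq, mul_div_mul_left _ _ (by positivity)]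
  rw [e, tsub_le_iff_right]
  calc (1 : ENNReal) = P Set.univ := measure_univ.symm
    _ ≤ P ({ω | |S n ω - ∫ ω', S n ω' ∂P| < gap n} ∪ {ω | gap n ≤ |S n ω - ∫ ω', S n ω' ∂P|}) :=
        measure_mono fun ω _ => lt_or_ge |S n ω - ∫ ω', S n ω' ∂P| (gap n)
    _ ≤ _ := (measure_union_le _ _).trans (by gcongr)

end Concentration

/-! ### Mean and variance of the normal-theory standard error -/

section NormalTheoryStandardError

variable {Ω : Type*} [MeasurableSpace Ω] {P : Measure Ω} [IsProbabilityMeasure P]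
  {X : ℕ → Ω → ℝ}

lemma memLp_normalTheorySE (hident : ∀ i, IdentDistrib (X i) (X 0) P P) (hmom : MemLp (X 0) 4 P)
    (n : ℕ) : MemLp (fun ω => normalTheorySE (firstObs X n ω)) 2 P := by
  simp_rw [normalTheorySE_eq]
  exact (memLp_varEstimator hident hmom n).const_mul _

lemma tendsto_sqrt_mul_integral_normalTheorySE (hindep : iIndepFun X P)
    (hident : ∀ i, IdentDistrib (X i) (X 0) P P) (hmom : MemLp (X 0) 4 P) :
    Tendsto (fun n : ℕ => √n * ∫ ω, normalTheorySE (firstObs X n ω) ∂P) atTop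
      (𝓝 (√2 * variance (X 0) P)) := by
  have h : Tendsto (fun n : ℕ => √2 * ((1 - 1 / (n : ℝ)) * variance (X 0) P)) atTop
      (𝓝 (√2 * ((1 - 0) * variance (X 0) P))) :=
    ((tendsto_one_div_atTop_nhds_zero_nat.const_sub 1).mul_const _).const_mul _
  rw [sub_zero, one_mul] at h
  refine h.congr' ?_
  filter_upwards [eventually_ne_atTop 0] with n hn
  simp_rw [normalTheorySE_eq]
  rw [integral_const_mul, integral_varEstimator hindep hident hmom hn]
  have hr : √(n : ℝ) ≠ 0 := by positivity
  field_simp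

lemma tendsto_mul_variance_normalTheorySE (hindep : iIndepFun X P)
    (hident : ∀ i, IdentDistrib (X i) (X 0) P P) (hmom : MemLp (X 0) 4 P) :
    Tendsto (fun n : ℕ => n * variance (fun ω => normalTheorySE (firstObs X n ω)) P) atTop
      (𝓝 0) := by
  have h := (tendsto_inv_atTop_nhds_zero_nat (𝕜 := ℝ)).mul
    ((tendsto_mul_variance_varEstimator hindep hident hmom).const_mul 2)
  rw [zero_mul] at h
  refine h.congr' ?_
  filter_upwards [eventually_ne_atTop 0] with n hn
  simp_rw [normalTheorySE_eq]
  rw [variance_const_mul, div_pow, Real.sq_sqrt n.cast_nonneg, Real.sq_sqrt zero_le_two]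
  field_simp

lemma tendsto_sqrt_mul_sqrt {V : ℕ → ℝ} {D : ℝ}
    (hV : Tendsto (fun n : ℕ => n * V n) atTop (𝓝 D)) :
    Tendsto (fun n : ℕ => √n * √(V n)) atTop (𝓝 √D) :=
  hV.sqrt.congr fun n => Real.sqrt_mul n.cast_nonneg _

end NormalTheoryStandardError

theorem proposition1 {Ω : Type*} [MeasurableSpace Ω] (P : Measure Ω) [IsProbabilityMeasure P]
    (X : ℕ → Ω → ℝ) (hindep : iIndepFun X P) (hident : ∀ i, IdentDistrib (X i) (X 0) P P)
    (hmom : MemLp (X 0) 4 P)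
    (μ σ κ : ℝ) (hσ : 0 < σ)
    (hmean : ∫ ω, X 0 ω ∂P = μ) (hvar : variance (X 0) P = σ ^ 2)
    (hkurt : excessKurtosis (X 0) P = κ) :
    -- the two estimators are the maximum likelihood estimators of the normal model
    (∀ (n : ℕ) (x : Fin n → ℝ), 0 < varEstimator x →
      ∀ θ : Fin 2 → ℝ, IsNormalMLE x θ ↔ θ = ![meanEstimator x, varEstimator x]) ∧
    -- the variance estimator is asymptotically normal with asymptotic variance `σ⁴ (κ + 2)`
    0 ≤ σ ^ 4 * (κ + 2) ∧
    TendstoInDistribution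
      (fun (n : ℕ) ω => √n * (varEstimator (firstObs X n ω) - σ ^ 2)) atTop
      (id : ℝ → ℝ) (fun _ => P) (gaussianReal 0 (σ ^ 4 * (κ + 2)).toNNReal) ∧
    -- its rescaled variance converges to the same value
    (∀ n : ℕ, MemLp (fun ω => varEstimator (firstObs X n ω)) 2 P) ∧
    Tendsto (fun n : ℕ => n * variance (fun ω => varEstimator (firstObs X n ω)) P) atTop
      (𝓝 (σ ^ 4 * (κ + 2))) ∧
    -- the Fisher information of the normal model predicts `2 σ⁴`
    fisherInformation normalDensity ![μ, σ ^ 2] = !![1 / σ ^ 2, 0; 0, 1 / (2 * σ ^ 4)] ∧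
    (fisherInformation normalDensity ![μ, σ ^ 2])⁻¹ = !![σ ^ 2, 0; 0, 2 * σ ^ 4] ∧
    -- comparison of the predicted and the actual asymptotic variance
    (2 * σ ^ 4 = σ ^ 4 * (κ + 2) ↔ κ = 0) ∧
    (2 * σ ^ 4 < σ ^ 4 * (κ + 2) ↔ 0 < κ) ∧
    (σ ^ 4 * (κ + 2) < 2 * σ ^ 4 ↔ κ < 0) ∧
    -- bias of the normal-theory standard error, relative to the standard deviation of the estimator
    (∀ n : ℕ, Integrable (fun ω => normalTheorySE (firstObs X n ω)) P) ∧
    Tendsto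
      (fun n : ℕ => √n * (∫ ω, normalTheorySE (firstObs X n ω) ∂P
        - √(variance (fun ω => varEstimator (firstObs X n ω)) P))) atTop
      (𝓝 (σ ^ 2 * (√2 - √(κ + 2)))) ∧
    -- positive excess kurtosis: too small, both in expectation and with probability tending to one
    (0 < κ →
      (∀ᶠ n : ℕ in atTop, ∫ ω, normalTheorySE (firstObs X n ω) ∂P
        < √(variance (fun ω => varEstimator (firstObs X n ω)) P)) ∧
      Tendsto (fun n : ℕ => P {ω | normalTheorySE (firstObs X n ω)
        < √(variance (fun ω' => varEstimator (firstObs X n ω')) P)}) atTop (𝓝 1)) ∧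
    -- negative excess kurtosis: too large, both in expectation and with probability tending to one
    (κ < 0 →
      (∀ᶠ n : ℕ in atTop, √(variance (fun ω => varEstimator (firstObs X n ω)) P)
        < ∫ ω, normalTheorySE (firstObs X n ω) ∂P) ∧
      Tendsto (fun n : ℕ => P {ω | √(variance (fun ω' => varEstimator (firstObs X n ω')) P)
        < normalTheorySE (firstObs X n ω)}) atTop (𝓝 1)) := by
  have hσ2 : 0 < σ ^ 2 := by positivity
  have hσ4 : 0 < σ ^ 4 := by positivity
  have hcm : centralMoment (X 0) 4 P - variance (X 0) P ^ 2 = σ ^ 4 * (κ + 2) := by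
    rw [← hkurt, excessKurtosis, hvar]
    field_simp
    ring
  -- The asymptotic variance is the variance of `(X 0 - μ) ^ 2`.
  have hD : 0 ≤ σ ^ 4 * (κ + 2) := by
    rw [← hcm, ← variance_sub_sq hmom hmean]
    exact variance_nonneg _ _
  have hκ : 0 ≤ κ + 2 := nonneg_of_mul_nonneg_right hD hσ4
  have hnVar := tendsto_mul_variance_varEstimator hindep hident hmom
  have hdist := tendstoInDistribution_varEstimator hindep hident hmom
  have hSE := tendsto_sqrt_mul_integral_normalTheorySE hindep hident hmom
  rw [hcm] at hnVar
  simp_rw [hcm, hvar] at hdist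
  rw [hvar] at hSE
  have hsd := tendsto_sqrt_mul_sqrt hnVar
  have hsqrt : √(σ ^ 4 * (κ + 2)) = σ ^ 2 * √(κ + 2) := by
    rw [Real.sqrt_mul hσ4.le, show σ ^ 4 = (σ ^ 2) ^ 2 by ring, Real.sqrt_sq hσ2.le]
  rw [hsqrt] at hsd
  have hdiff : Tendsto (fun n : ℕ => √n * (∫ ω, normalTheorySE (firstObs X n ω) ∂P
      - √(variance (fun ω => varEstimator (firstObs X n ω)) P))) atTop
      (𝓝 (σ ^ 2 * (√2 - √(κ + 2)))) := by
    simp_rw [mul_sub]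
    rw [mul_comm (σ ^ 2) √2]
    exact hSE.sub hsd
  have hS := memLp_normalTheorySE hident hmom
  have hSV := tendsto_mul_variance_normalTheorySE hindep hident hmom
  have hF := fisherInformation_normalDensity (m := μ) hσ2
  have hFi := inv_fisherInformation_normalDensity (m := μ) hσ2
  rw [show (σ ^ 2) ^ 2 = σ ^ 4 by ring] at hF hFi
  refine ⟨fun n x hx θ => isNormalMLE_iff hx θ, hD, hdist, memLp_varEstimator hident hmom, hnVar,
    hF, hFi, ?_, ?_, ?_, fun n => (hS n).integrable (by norm_num), hdiff, fun hpos => ?_,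
    fun hneg => ?_⟩
  · rw [mul_comm, mul_right_inj' hσ4.ne']
    constructor <;> intro h <;> linarith
  · rw [mul_comm, mul_lt_mul_iff_right₀ hσ4]
    constructor <;> intro h <;> linarith
  · rw [mul_comm 2, mul_lt_mul_iff_right₀ hσ4]
    constructor <;> intro h <;> linarith
  · have hlt : σ ^ 2 * (√2 - √(κ + 2)) < 0 :=
      mul_neg_of_pos_of_neg hσ2 (sub_neg.2 (Real.sqrt_lt_sqrt zero_le_two (by linarith)))
    constructor
    · filter_upwards [hdiff.eventually_lt_const hlt] with n hn
      by_contra! h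
      exact hn.not_ge (mul_nonneg (Real.sqrt_nonneg _) (sub_nonneg.2 h))
    -- The gap is the true standard deviation minus the mean of the normal-theory one; a deviation
    -- smaller than the gap cannot cross the true value.
    · have hgap := hdiff.neg
      simp_rw [← mul_neg, neg_sub] at hgap
      refine tendsto_of_tendsto_of_tendsto_of_le_of_le
        (tendsto_measure_abs_sub_lt hS hSV (by linarith) hgap) tendsto_const_nhds
        (fun n => measure_mono fun ω hω => ?_) fun n => prob_le_one
      simp only [Set.mem_ofPred_eq] at hω ⊢
      have := (abs_lt.1 hω).2
      linarith
  · have hlt : 0 < σ ^ 2 * (√2 - √(κ + 2)) :=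
      mul_pos hσ2 (sub_pos.2 (Real.sqrt_lt_sqrt hκ (by linarith)))
    constructor
    · filter_upwards [hdiff.eventually_const_lt hlt] with n hn
      by_contra! h
      exact hn.not_ge (mul_nonpos_of_nonneg_of_nonpos (Real.sqrt_nonneg _) (sub_nonpos.2 h))
    · refine tendsto_of_tendsto_of_tendsto_of_le_of_le
        (tendsto_measure_abs_sub_lt hS hSV hlt hdiff) tendsto_const_nhds
        (fun n => measure_mono fun ω hω => ?_) fun n => prob_le_one
      simp only [Set.mem_ofPred_eq] at hω ⊢
      have := (abs_lt.1 hω).1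
      linarith
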